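/- Let $\mathcal{T}$ be a triangulated category with shift $[1]$. Let $\mathcal{A}\subset\mathcal{T}$ be a full additive subcategory, closed under extensions, such that $\operatorname{Hom}_{\mathcal{T}}(A,B[-1])=0$ for all $A,B\in\mathcal{A}$. Call $B\to X\to A$ in $\mathcal{A}$ a conflation if it can be completed to a distinguished triangle $B\to X\to A\to B[1]$ of $\mathcal{T}$ (the morphism $A\to B[1]$ is then unique). For $n\ge 1$, an $n$-extension of $A$ by $B$ is a sequence $0\to B\to X_1\to\dots\to X_n\to A\to 0$ in $\mathcal{A}$ obtained by splicing conflations $B\to X_1\to C_1$, $C_1\to X_2\to C_2$, …, $C_{n-1}\to X_n\to A$. Let $\operatorname{Ext}^n_{\mathcal{A}}(A,B)$ be the set of $n$-extensions modulo the equivalence relation generated by the existence of a commutative ladder that is the identity on $A$ and $B$, with addition given by the Baer sum $\mathbf{X}+\mathbf{Y}=\nabla_B\cdot(\mathbf{X}\oplus\mathbf{Y})\cdot\Delta_A$, and let $\operatorname{Ext}^0_{\mathcal{A}}(A,B)=\operatorname{Hom}_{\mathcal{A}}(A,B)$. Sending an $n$-extension to the composition of the shifted connecting morphisms $A\to C_{n-1}[1]\to\dots\to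 C_1[n-1]\to B[n]$ (and a morphism to itself if $n=0$) gives a well-defined map $f_{n,A,B}:\operatorname{Ext}^n_{\mathcal{A}}(A,B)\to\operatorname{Hom}_{\mathcal{T}}(A,B[n])$. One says that $\mathcal{T}$ has all the Ext groups of $\mathcal{A}$ if $f_{n,A,B}$ is an isomorphism of groups for all $n\ge 0$ and all $A,B\in\mathcal{A}$. 1. $\mathcal{T}$ has all the Ext groups of $\mathcal{A}$ if and only if, for all $n\ge 1$ and all $A,B\in\mathcal{A}$, every morphism $A\to B[n]$ in $\mathcal{T}$ factors as $$A\to C_{n-1}[1]\to C_{n-2}[2]\to\dots\to C_1[n-1]\to B[n]$$ with $C_1,\dots,C_{n-1}\in\mathcal{A}$. 2. Let $\mathcal{A}$ be the heart of a t-structure on $\mathcal{T}$ (such a heart satisfies the above conditions). Let $\dim_{\mathcal{T}}\mathcal{A}$ be the supremum of the integers $n$ such that $\operatorname{Hom}_{\mathcal{T}}(A,B[n])\ne 0$ for some $A,B\in\mathcal{A}$, and let $\dim\mathcal{A}$ be the supremum of the integers $n\ge 0$ such that $\operatorname{Ext}^n(A,B)\neq 0$ for some $A,B\in\mathcal{A}$,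 where $\operatorname{Ext}^n$ denotes the Yoneda extensions of the abelian category $\mathcal{A}$, defined as above with the short exact sequences of $\mathcal{A}$ as conflations (both suprema are $-\infty$ if $\mathcal{A}=0$). If $\dim_{\mathcal{T}}\mathcal{A}\le 1$, then $\mathcal{T}$ has all the Ext groups of $\mathcal{A}$ and $\dim\mathcal{A}=\dim_{\mathcal{T}}\mathcal{A}$. -/

import Mathlib

open CategoryTheory Category Limits Pretriangulated Triangulated

universe v u

-- The quiver of a category is taken directly from its category structure.
attribute [-instance] CategoryTheory.catToReflQuiver

namespace ExtGroups

/-! ### Yoneda extensions with respect to a class of conflations -/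

section Yoneda

variable {D : Type u} [Category.{v} D]

/-- A class of conflations: a predicate on composable pairs `X ⟶ Y ⟶ Z`. -/
abbrev ConflationClass (D : Type u) [Category.{v} D] : Type (max u v) :=
  ∀ ⦃X Y Z : D⦄, (X ⟶ Y) → (Y ⟶ Z) → Prop

/-- `NExtension conf A k B` is the type of `(k + 1)`-extensions
`0 ⟶ B ⟶ X₁ ⟶ ⋯ ⟶ X_{k+1} ⟶ A ⟶ 0` of `A` by `B`, i.e. of sequences obtained by splicing
conflations `B ⟶ X₁ ⟶ C₁`, `C₁ ⟶ X₂ ⟶ C₂`, …, `C_k ⟶ X_{k+1} ⟶ A`. -/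
inductive NExtension (conf : ConflationClass D) (A : D) : ℕ → D → Type (max u v)
  | single {B X : D} (i : B ⟶ X) (p : X ⟶ A) (h : conf i p) : NExtension conf A 0 B
  | splice {k : ℕ} {B X K : D} (i : B ⟶ X) (p : X ⟶ K) (h : conf i p)
      (E : NExtension conf A k K) : NExtension conf A (k + 1) B

namespace NExtension

variable {conf : ConflationClass D} {A : D}

/-- The first middle term `X₁` of an extension. -/
def firstObj : ∀ {k : ℕ} {B : D}, NExtension conf A k B → D
  | _, _, single (X := X) _ _ _ => X
  | _, _, splice (X := X) _ _ _ _ => X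

/-- The first map `ξ₀ : B ⟶ X₁` of an extension. -/
def firstMap : ∀ {k : ℕ} {B : D} (E : NExtension conf A k B), B ⟶ E.firstObj
  | _, _, single i _ _ => i
  | _, _, splice i _ _ _ => i

/-- Given `ψ₁ : X₁ ⟶ Y₁`, there are maps `ψ₂ : X₂ ⟶ Y₂`, … such that all the squares
to the right of `ψ₁` commute, the last one being over the identity of `A`.
The map `X₁ ⟶ X₂` is the composition `X₁ ⟶ C₁ ⟶ X₂`. -/
def LadderFrom : ∀ {k : ℕ} {B B' : D} (E : NExtension conf A k B) (E' : NExtension conf A k B'),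
    (E.firstObj ⟶ E'.firstObj) → Prop
  | _, _, _, single _ p _, single _ p' _, ψ => ψ ≫ p' = p
  | _, _, _, splice _ p _ E, splice _ p' _ E', ψ =>
      ∃ ψ' : E.firstObj ⟶ E'.firstObj,
        (p ≫ E.firstMap) ≫ ψ' = ψ ≫ (p' ≫ E'.firstMap) ∧ LadderFrom E E' ψ'

/-- There is a family `ψ₁, …, ψ_{k+1}` of morphisms between the middle terms of two extensions
of `A` by `B` which, together with the identities of `A` and `B`, form a commutative diagram. -/
def Rel {k : ℕ} {B : D} (E E' : NExtension conf A k B) : Prop :=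
  ∃ ψ : E.firstObj ⟶ E'.firstObj, E.firstMap ≫ ψ = E'.firstMap ∧ LadderFrom E E' ψ

/-- Existence of a morphism of extensions over `α : A ⟶ A'` and `β : B ⟶ B'`,
given by maps between the middle terms `X_i` and between the `C_i`. -/
def IsOver {A A' : D} (α : A ⟶ A') : ∀ {k : ℕ} {B B' : D} (_ : B ⟶ B')
    (_ : NExtension conf A k B) (_ : NExtension conf A' k B'), Prop
  | _, _, _, β, single (X := X) i p _, single (X := X') i' p' _ =>
      ∃ ψ : X ⟶ X', i ≫ ψ = β ≫ i' ∧ ψ ≫ p' = p ≫ α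
  | _, _, _, β, splice (X := X) (K := K) i p _ E, splice (X := X') (K := K') i' p' _ E' =>
      ∃ (ψ : X ⟶ X') (φ : K ⟶ K'), i ≫ ψ = β ≫ i' ∧ ψ ≫ p' = p ≫ φ ∧ IsOver α φ E E'

lemma IsOver.comp {A A' A'' : D} {α : A ⟶ A'} {α' : A' ⟶ A''} {k : ℕ} {B B' B'' : D} {β : B ⟶ B'}
    {β' : B' ⟶ B''} {E : NExtension conf A k B} {E' : NExtension conf A' k B'}
    {E'' : NExtension conf A'' k B''} (h : IsOver α β E E') (h' : IsOver α' β' E' E'') :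
    IsOver (α ≫ α') (β ≫ β') E E'' := by
  induction E generalizing B' B'' with
  | single i p hc =>
    cases E' with
    | single i' p' hc' =>
    cases E'' with
    | single i'' p'' hc'' =>
    obtain ⟨ψ, h₁, h₂⟩ := h
    obtain ⟨ψ', h₁', h₂'⟩ := h'
    exact ⟨ψ ≫ ψ', by rw [reassoc_of% h₁, h₁', assoc], by rw [assoc, h₂', reassoc_of% h₂]⟩
  | splice i p hc E ih =>
    cases E' with
    | splice i' p' hc' E' =>
    cases E'' with
    | splice i'' p'' hc'' E'' =>
    obtain ⟨ψ, φ, h₁, h₂, h₃⟩ := h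
    obtain ⟨ψ', φ', h₁', h₂', h₃'⟩ := h'
    exact ⟨ψ ≫ ψ', φ ≫ φ', by rw [reassoc_of% h₁, h₁', assoc],
      by rw [assoc, h₂', reassoc_of% h₂], ih h₃ h₃'⟩

lemma IsOver.refl {A : D} {k : ℕ} {B : D} (E : NExtension conf A k B) : IsOver (𝟙 A) (𝟙 B) E E := by
  induction E with
  | single i p hc => exact ⟨𝟙 _, by simp, by simp⟩
  | splice i p hc E ih => exact ⟨𝟙 _, 𝟙 _, by simp, by simp, ih⟩

end NExtension

/-- The Yoneda extensions `Extⁿ(A, B)` with respect to a class of conflations: morphisms `A ⟶ B`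
for `n = 0`, and the quotient of the `n`-extensions by the equivalence relation generated by
`NExtension.Rel` for `n > 0`. -/
def YExt (conf : ConflationClass D) : ℕ → D → D → Type (max u v)
  | 0, A, B => ULift.{u} (A ⟶ B)
  | k + 1, A, B => Quot (NExtension.Rel : NExtension conf A k B → NExtension conf A k B → Prop)

/-- The greatest `n` such that `Extⁿ(A, B) ≠ 0` for some `A` and `B` (the supremum is
`⊥` if there is no such `n`, and `⊤` if these `n` are not bounded). -/
noncomputable def extDim (conf : ConflationClass D) : WithBot (WithTop ℤ) :=
  ⨆ (n : ℕ) (_ : ∃ A B : D, Nontrivial (YExt conf n A B)), (((n : ℤ) : WithTop ℤ) : WithBot (WithTop ℤ))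

end Yoneda

/-- The short exact sequences of an abelian category. -/
def shortExactSequences (D : Type u) [Category.{v} D] [Preadditive D] : ConflationClass D :=
  fun _ _ _ i p => ∃ w : i ≫ p = 0, (ShortComplex.mk i p w).ShortExact

/-- The (absolute) homological dimension `dim D` of an abelian category. -/
noncomputable def absDim (D : Type u) [Category.{v} D] [Preadditive D] : WithBot (WithTop ℤ) :=
  extDim (shortExactSequences D)

/-! ### Exact subcategories of triangulated categories -/

lemma comp_shift_inv_hom {C : Type u} [Category.{v} C] [HasShift C ℤ] {X Y Z W : C} (a : X ⟶ Y) (m : Y ⟶ Z⟦(1 : ℤ)⟧) (e : W ≅ Z) :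
    (a ≫ m ≫ e.inv⟦(1 : ℤ)⟧') ≫ e.hom⟦(1 : ℤ)⟧' = a ≫ m := by
  rw [assoc, assoc, ← Functor.map_comp, Iso.inv_hom_id, CategoryTheory.Functor.map_id, comp_id]

section Triangulated

variable {C : Type u} [Category.{v} C] [Preadditive C] [HasZeroObject C] [HasShift C ℤ]
  [∀ n : ℤ, (shiftFunctor C n).Additive] [Pretriangulated C]

/-- A full additive subcategory, closed under extensions, such that `Hom(A, B[-1]) = 0` for all
its objects `A` and `B`. (Closure under finite direct sums and isomorphisms follows from
closure under extensions.) -/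
class IsDyerSubcategory (P : ObjectProperty C) : Prop where
  exists_zero : ∃ Z : C, IsZero Z ∧ P Z
  ext_closed : ∀ T ∈ distTriang C, P T.obj₁ → P T.obj₃ → P T.obj₂
  hom_zero : ∀ {A B : C}, P A → P B → ∀ f : A ⟶ B⟦(-1 : ℤ)⟧, f = 0

/-- The exact structure on a full subcategory of a triangulated category:
`A ⟶ B ⟶ C` is a conflation if it can be completed to a distinguished triangle. -/
def triangleConflations (P : ObjectProperty C) : ConflationClass P.FullSubcategory :=
  fun X _ Z i p => ∃ γ : Z.obj ⟶ X.obj⟦(1 : ℤ)⟧, Triangle.mk i.hom p.hom γ ∈ distTriang C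

/-- The homological dimension `dim_T P` of a full subcategory: the greatest integer `n` such that
`Hom(A, B[n]) ≠ 0` for some `A` and `B` in `P` (the supremum is `⊥` if there is no such `n`,
and `⊤` if these `n` are not bounded above). -/
noncomputable def dimIn (P : ObjectProperty C) : WithBot (WithTop ℤ) :=
  ⨆ (n : ℤ) (_ : ∃ A B : C, P A ∧ P B ∧ ∃ f : A ⟶ B⟦n⟧, f ≠ 0), ((n : WithTop ℤ) : WithBot (WithTop ℤ))

/-- `FactorsThrough P A n B g` says that `g : A ⟶ B[n]` (with `n ≥ 1`) is a composition
`A ⟶ C_{n-1}[1] ⟶ ⋯ ⟶ C₁[n-1] ⟶ B[n]` with all `C_i` in `P`. -/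
inductive FactorsThrough (P : ObjectProperty C) (A : C) :
    ∀ (n : ℕ) (B : C), (A ⟶ B⟦(n : ℤ)⟧) → Prop
  | one {B : C} (g : A ⟶ B⟦((1 : ℕ) : ℤ)⟧) : FactorsThrough P A 1 B g
  | step {n : ℕ} {K B : C} (hK : P K) (g : A ⟶ K⟦(n : ℤ)⟧) (hg : FactorsThrough P A n K g)
      (h : K⟦(n : ℤ)⟧ ⟶ B⟦((n + 1 : ℕ) : ℤ)⟧) : FactorsThrough P A (n + 1) B (g ≫ h)

/-- A chosen comparison between the biproduct and the product of a pair of objects. -/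
noncomputable def biprodIsoPi (F : WalkingPair → C) : F .left ⊞ F .right ≅ ∏ᶜ F where
  hom := Pi.lift (fun j => match j with
    | .left => biprod.fst
    | .right => biprod.snd)
  inv := biprod.lift (Pi.π F .left) (Pi.π F .right)
  hom_inv_id := by ext <;> simp
  inv_hom_id := by
    apply Pi.hom_ext
    rintro (_ | _) <;> simp

lemma biprodIsoPi_left (F : WalkingPair → C) :
    (biprodIsoPi F).hom ≫ Pi.π F .left = biprod.fst := by simp [biprodIsoPi]

lemma biprodIsoPi_right (F : WalkingPair → C) :
    (biprodIsoPi F).hom ≫ Pi.π F .right = biprod.snd := by simp [biprodIsoPi]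

lemma biprodIsoPi_natural (F G : WalkingPair → C) (f : ∀ j, F j ⟶ G j) :
    biprod.map (f .left) (f .right) ≫ (biprodIsoPi G).hom =
      (biprodIsoPi F).hom ≫ Limits.Pi.map f := by
  apply Pi.hom_ext
  rintro (_ | _)
  · rw [assoc, assoc, biprodIsoPi_left, Limits.Pi.map_π, biprod.map_fst, ← assoc,
      biprodIsoPi_left]
  · rw [assoc, assoc, biprodIsoPi_right, Limits.Pi.map_π, biprod.map_snd, ← assoc,
      biprodIsoPi_right]

lemma biprod_distinguished' (T : WalkingPair → Triangle C) (hT : ∀ j, T j ∈ distTriang C) :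
    ∃ δ, Triangle.mk (biprod.map (T .left).mor₁ (T .right).mor₁)
      (biprod.map (T .left).mor₂ (T .right).mor₂) δ ∈ distTriang C := by
  refine ⟨(biprodIsoPi fun j => (T j).obj₃).hom ≫ (productTriangle T).mor₃ ≫
    (biprodIsoPi fun j => (T j).obj₁).inv⟦(1 : ℤ)⟧', ?_⟩
  refine isomorphic_distinguished _ (productTriangle_distinguished T hT) _ ?_
  refine Triangle.isoMk _ _ (biprodIsoPi fun j => (T j).obj₁) (biprodIsoPi fun j => (T j).obj₂)
    (biprodIsoPi fun j => (T j).obj₃) ?_ ?_ ?_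
  · exact biprodIsoPi_natural _ _ fun j => (T j).mor₁
  · exact biprodIsoPi_natural _ _ fun j => (T j).mor₂
  · exact comp_shift_inv_hom _ _ _

lemma biprod_distinguished {X Y Z X' Y' Z' : C} {i : X ⟶ Y} {p : Y ⟶ Z} {γ : Z ⟶ X⟦(1 : ℤ)⟧}
    {i' : X' ⟶ Y'} {p' : Y' ⟶ Z'} {γ' : Z' ⟶ X'⟦(1 : ℤ)⟧}
    (h : Triangle.mk i p γ ∈ distTriang C) (h' : Triangle.mk i' p' γ' ∈ distTriang C) :
    ∃ δ, Triangle.mk (biprod.map i i') (biprod.map p p') δ ∈ distTriang C :=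
  biprod_distinguished' (fun j => match j with
    | .left => Triangle.mk i p γ
    | .right => Triangle.mk i' p' γ') (by rintro (_ | _) <;> assumption)

section

variable {P : ObjectProperty C} {B X A B' X' A' : P.FullSubcategory}
  {i : B ⟶ X} {p : X ⟶ A} {i' : B' ⟶ X'} {p' : X' ⟶ A'}

lemma conf_zero (h : triangleConflations P i p) : i ≫ p = 0 := by
  obtain ⟨γ, hγ⟩ := h
  ext
  exact comp_distTriang_mor_zero₁₂ _ hγ

lemma conf_desc (h : triangleConflations P i p) {Z : P.FullSubcategory} (f : X ⟶ Z)
    (hf : i ≫ f = 0) : ∃ g : A ⟶ Z, f = p ≫ g := by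
  obtain ⟨γ, hγ⟩ := h
  obtain ⟨t, ht⟩ := Triangle.yoneda_exact₂ _ hγ f.hom (congrArg (·.hom) hf)
  exact ⟨P.homMk t, by ext; exact ht⟩

/-- The connecting morphism `A ⟶ B[1]` of a conflation `B ⟶ X ⟶ A`; it is unique,
see `conf_natural`. -/
noncomputable def conn (h : triangleConflations P i p) : A.obj ⟶ B.obj⟦(1 : ℤ)⟧ := h.choose

lemma conn_mem (h : triangleConflations P i p) :
    Triangle.mk i.hom p.hom (conn h) ∈ distTriang C := h.choose_spec

lemma exists_middle (h : triangleConflations P i p) (h' : triangleConflations P i' p')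
    (β : B ⟶ B') (φ : A ⟶ A') (hφ : φ.hom ≫ conn h' = conn h ≫ β.hom⟦(1 : ℤ)⟧') :
    ∃ ψ : X ⟶ X', i ≫ ψ = β ≫ i' ∧ ψ ≫ p' = p ≫ φ := by
  obtain ⟨c, hc₁, hc₂⟩ := complete_distinguished_triangle_morphism₂ _ _ (conn_mem h) (conn_mem h')
    β.hom φ.hom hφ.symm
  exact ⟨P.homMk c, by ext; exact hc₁, by ext; exact hc₂.symm⟩

end

section Dyer

variable {P : ObjectProperty C} [IsDyerSubcategory P]

lemma hom_shift_one_eq_zero {A B : C} (hA : P A) (hB : P B) (f : A⟦(1 : ℤ)⟧ ⟶ B) : f = 0 := by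
  apply (shiftFunctor C (-1 : ℤ)).map_injective
  rw [Functor.map_zero, ← cancel_epi ((shiftFunctorCompIsoId C (1 : ℤ) (-1) (by simp)).inv.app A),
    comp_zero]
  exact IsDyerSubcategory.hom_zero hA hB _

section

variable {B X A B' X' A' : P.FullSubcategory} {i : B ⟶ X} {p : X ⟶ A} {i' : B' ⟶ X'} {p' : X' ⟶ A'}

lemma conf_epi (h : triangleConflations P i p) {Z : P.FullSubcategory} {f g : A ⟶ Z}
    (hfg : p ≫ f = p ≫ g) : f = g := by
  obtain ⟨γ, hγ⟩ := h
  ext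
  rw [← sub_eq_zero]
  have h0 : p.hom ≫ (f.hom - g.hom) = 0 := by
    rw [Preadditive.comp_sub, sub_eq_zero]
    exact congrArg (·.hom) hfg
  obtain ⟨t, ht⟩ := Triangle.yoneda_exact₃ _ hγ (f.hom - g.hom) h0
  rw [ht, hom_shift_one_eq_zero B.property Z.property t]
  exact comp_zero

lemma conf_mono (h : triangleConflations P i p) {Z : P.FullSubcategory} {f g : Z ⟶ B}
    (hfg : f ≫ i = g ≫ i) : f = g := by
  obtain ⟨γ, hγ⟩ := h
  ext
  rw [← sub_eq_zero]
  have h0 : (f.hom - g.hom) ≫ i.hom = 0 := by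
    rw [Preadditive.sub_comp, sub_eq_zero]
    exact congrArg (·.hom) hfg
  obtain ⟨t, ht⟩ := Triangle.coyoneda_exact₂ _ (inv_rot_of_distTriang _ hγ) (f.hom - g.hom) h0
  have : t = 0 := IsDyerSubcategory.hom_zero Z.property A.property t
  rw [ht, this]
  exact zero_comp

lemma conf_natural {γ : A.obj ⟶ B.obj⟦(1 : ℤ)⟧} {γ' : A'.obj ⟶ B'.obj⟦(1 : ℤ)⟧}
    (hγ : Triangle.mk i.hom p.hom γ ∈ distTriang C)
    (hγ' : Triangle.mk i'.hom p'.hom γ' ∈ distTriang C)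
    (β : B ⟶ B') (ψ : X ⟶ X') (φ : A ⟶ A') (h₁ : i ≫ ψ = β ≫ i') (h₂ : ψ ≫ p' = p ≫ φ) :
    φ.hom ≫ γ' = γ ≫ β.hom⟦(1 : ℤ)⟧' := by
  obtain ⟨c, hc₁, hc₂⟩ := complete_distinguished_triangle_morphism _ _ hγ hγ' β.hom ψ.hom
    (congrArg (·.hom) h₁)
  have : φ = P.homMk c := by
    apply conf_epi ⟨γ, hγ⟩
    rw [← h₂]
    ext
    exact hc₁.symm
  subst this
  exact hc₂.symm

lemma conn_natural (h : triangleConflations P i p) (h' : triangleConflations P i' p')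
    (β : B ⟶ B') (ψ : X ⟶ X') (φ : A ⟶ A') (h₁ : i ≫ ψ = β ≫ i') (h₂ : ψ ≫ p' = p ≫ φ) :
    φ.hom ≫ conn h' = conn h ≫ β.hom⟦(1 : ℤ)⟧' :=
  conf_natural (conn_mem h) (conn_mem h') β ψ φ h₁ h₂

lemma exists_conf (γ : A.obj ⟶ B.obj⟦(1 : ℤ)⟧) :
    ∃ (Y : P.FullSubcategory) (j : B ⟶ Y) (q : Y ⟶ A) (h : triangleConflations P j q),
      conn h = γ := by
  obtain ⟨Y, j, q, hT⟩ := distinguished_cocone_triangle₂ γ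
  have hY : P Y := IsDyerSubcategory.ext_closed _ hT B.property A.property
  have h : triangleConflations P (P.homMk j : B ⟶ ⟨Y, hY⟩) (P.homMk q) := ⟨γ, hT⟩
  refine ⟨⟨Y, hY⟩, P.homMk j, P.homMk q, h, ?_⟩
  have := conf_natural (P := P) (i := P.homMk j) (p := P.homMk q) (i' := P.homMk j)
    (p' := P.homMk q) hT (conn_mem h) (𝟙 B) (𝟙 (⟨Y, hY⟩ : P.FullSubcategory)) (𝟙 A)
    (by simp) (by simp)
  simpa using this

/-- A pushout of the conflation `B ⟶ X ⟶ A` along `g : B ⟶ B'`: a conflation `B' ⟶ Y ⟶ A`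
with a morphism `X ⟶ Y` making the diagram commute. (The square `B, X, B', Y` is then a
pushout, and the conflation is unique up to isomorphism.) -/
structure PushData (_ : triangleConflations P i p) (g : B ⟶ B') where
  (Y : P.FullSubcategory) (j : B' ⟶ Y) (q : Y ⟶ A) (conf : triangleConflations P j q) (ψ : X ⟶ Y)
  w₁ : i ≫ ψ = g ≫ j
  w₂ : ψ ≫ q = p ≫ 𝟙 A

/-- A pullback of the conflation `B ⟶ X ⟶ A` along `a : A' ⟶ A`: a conflation `B ⟶ Y ⟶ A'`
with a morphism `Y ⟶ X` making the diagram commute. (The square `Y, X, A', A` is then a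
pullback, and the conflation is unique up to isomorphism.) -/
structure PullData (_ : triangleConflations P i p) (a : A' ⟶ A) where
  (Y : P.FullSubcategory) (j : B ⟶ Y) (q : Y ⟶ A') (conf : triangleConflations P j q) (ψ : Y ⟶ X)
  w₁ : j ≫ ψ = 𝟙 B ≫ i
  w₂ : ψ ≫ p = q ≫ a

lemma nonempty_pushData (h : triangleConflations P i p) (g : B ⟶ B') :
    Nonempty (PushData h g) := by
  obtain ⟨Y, j, q, hj, hγ⟩ := exists_conf (conn h ≫ g.hom⟦(1 : ℤ)⟧')
  obtain ⟨ψ, h₁, h₂⟩ := exists_middle h hj g (𝟙 A) (by simpa using hγ)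
  exact ⟨⟨Y, j, q, hj, ψ, h₁, h₂⟩⟩

lemma nonempty_pullData (h : triangleConflations P i p) (a : A' ⟶ A) :
    Nonempty (PullData h a) := by
  obtain ⟨Y, j, q, hj, hγ⟩ := exists_conf (a.hom ≫ conn h)
  obtain ⟨ψ, h₁, h₂⟩ := exists_middle hj h (𝟙 B) a (by simpa using hγ.symm)
  exact ⟨⟨Y, j, q, hj, ψ, h₁, h₂⟩⟩

/-- A chosen pushout of a conflation. -/
noncomputable def pushData (h : triangleConflations P i p) (g : B ⟶ B') : PushData h g :=
  (nonempty_pushData h g).some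

/-- A chosen pullback of a conflation. -/
noncomputable def pullData (h : triangleConflations P i p) (a : A' ⟶ A) : PullData h a :=
  (nonempty_pullData h a).some

lemma PushData.conn_eq {h : triangleConflations P i p} {g : B ⟶ B'} (d : PushData h g) :
    conn d.conf = conn h ≫ g.hom⟦(1 : ℤ)⟧' := by
  simpa using conn_natural h d.conf g d.ψ (𝟙 A) d.w₁ d.w₂

lemma PullData.conn_eq {h : triangleConflations P i p} {a : A' ⟶ A} (d : PullData h a) :
    conn d.conf = a.hom ≫ conn h := by
  simpa using (conn_natural d.conf h (𝟙 B) d.ψ a d.w₁ d.w₂).symm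

end

/-- The `(k + 1)`-extensions of `A` by `B` in the exact subcategory `P`. -/
abbrev NExt (P : ObjectProperty C) (A : P.FullSubcategory) (k : ℕ) (B : P.FullSubcategory) :=
  NExtension (triangleConflations P) A k B

open NExtension

lemma exists_ladder_iff_isOver {A : P.FullSubcategory} {k : ℕ} {B B' : P.FullSubcategory}
    (β : B ⟶ B') (E : NExt P A k B) (E' : NExt P A k B') :
    (∃ ψ : E.firstObj ⟶ E'.firstObj, E.firstMap ≫ ψ = β ≫ E'.firstMap ∧ LadderFrom E E' ψ) ↔
      IsOver (𝟙 A) β E E' := by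
  induction E generalizing B' with
  | single i p hc =>
    cases E' with
    | single i' p' hc' =>
    simp [IsOver, LadderFrom, firstObj, firstMap]
  | @splice k B X K i p hc E ih =>
    cases E' with
    | @splice _ _ X' K' i' p' hc' E' =>
    constructor
    · rintro ⟨ψ, h₁, ψ', h₂, h₃⟩
      change X ⟶ X' at ψ
      change i ≫ ψ = β ≫ i' at h₁
      change (p ≫ E.firstMap) ≫ ψ' = ψ ≫ (p' ≫ E'.firstMap) at h₂
      have hm : ∃ j q, ∃ (_ : triangleConflations P E'.firstMap (q : _ ⟶ j)), True := by
        cases E' with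
        | single _ q h => exact ⟨_, q, h, trivial⟩
        | splice _ q h _ => exact ⟨_, q, h, trivial⟩
      obtain ⟨j, q, hq, -⟩ := hm
      obtain ⟨φ, hφ⟩ := conf_desc hc (ψ ≫ p') (by
        apply conf_mono hq
        have hz := conf_zero hc
        rw [assoc, assoc, ← h₂, assoc, reassoc_of% hz, zero_comp, zero_comp])
      refine ⟨ψ, φ, h₁, hφ, (ih φ E').1 ⟨ψ', ?_, h₃⟩⟩
      apply conf_epi hc
      rw [← assoc, h₂, ← assoc, hφ, assoc]
    · rintro ⟨ψ, φ, h₁, h₂, h₃⟩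
      obtain ⟨ψ', h₄, h₅⟩ := (ih φ E').2 h₃
      refine ⟨ψ, h₁, ψ', ?_, h₅⟩
      change (p ≫ E.firstMap) ≫ ψ' = ψ ≫ (p' ≫ E'.firstMap)
      rw [assoc, h₄, ← assoc, ← h₂, assoc]

lemma rel_iff_isOver {A : P.FullSubcategory} {k : ℕ} {B : P.FullSubcategory}
    (E E' : NExt P A k B) : NExtension.Rel E E' ↔ IsOver (𝟙 A) (𝟙 B) E E' := by
  rw [← exists_ladder_iff_isOver]
  simp [NExtension.Rel]

/-- The map `A ⟶ C_k[1] ⟶ ⋯ ⟶ C₁[k] ⟶ B[k+1]` associated to a `(k + 1)`-extension of `A` by `B`,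
the composition of the shifts of the connecting morphisms of its conflations. -/
noncomputable def val {A : P.FullSubcategory} : ∀ {k : ℕ} {B : P.FullSubcategory},
    NExt P A k B → (A.obj ⟶ B.obj⟦((k + 1 : ℕ) : ℤ)⟧)
  | _, _, single _ _ h =>
      (ShiftedHom.mk₀ (0 : ℤ) rfl (𝟙 A.obj)).comp (conn h) (by simp)
  | _, _, splice _ _ h E => ShiftedHom.comp (val E) (conn h) (by push_cast; ring)

lemma val_natural {A A' : P.FullSubcategory} (α : A ⟶ A') {k : ℕ} {B B' : P.FullSubcategory}
    (β : B ⟶ B') (E : NExt P A k B) (E' : NExt P A' k B') (h : IsOver α β E E') :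
    α.hom ≫ val E' = val E ≫ β.hom⟦((k + 1 : ℕ) : ℤ)⟧' := by
  induction E generalizing B' with
  | single i p hc =>
    cases E' with
    | single i' p' hc' =>
    obtain ⟨ψ, h₁, h₂⟩ := h
    have := conn_natural hc hc' β ψ α h₁ h₂
    have h₃ := (shiftFunctorAdd' C (1 : ℤ) 0 ((0 + 1 : ℕ) : ℤ) (by simp)).inv.naturality β.hom
    have h₄ := (shiftFunctorZero' C (0 : ℤ) rfl).inv.naturality α.hom
    simp only [val, ShiftedHom.comp, ShiftedHom.mk₀, id_comp, assoc, Functor.id_map] at h₃ h₄ ⊢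
    rw [← h₃, reassoc_of% h₄, ← Functor.map_comp_assoc, this, Functor.comp_map,
      ← Functor.map_comp_assoc]
  | @splice k B X K i p hc E ih =>
    cases E' with
    | splice i' p' hc' E' =>
    obtain ⟨ψ, φ, h₁, h₂, h₃⟩ := h
    have h₄ := conn_natural hc hc' β ψ φ h₁ h₂
    have h₅ := ih _ _ h₃
    have h₆ := (shiftFunctorAdd' C (1 : ℤ) ((k + 1 : ℕ) : ℤ) ((k + 1 + 1 : ℕ) : ℤ)
      (by push_cast; ring)).inv.naturality β.hom
    simp only [val, ShiftedHom.comp, assoc]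
    rw [← h₆, reassoc_of% h₅, ← Functor.map_comp_assoc, h₄, Functor.comp_map,
      ← Functor.map_comp_assoc]

/-- The map `f_{n,A,B} : Extⁿ(A, B) ⟶ Hom(A, B[n])`. -/
noncomputable def extMap : ∀ (n : ℕ) (A B : P.FullSubcategory),
    YExt (triangleConflations P) n A B → (A.obj ⟶ B.obj⟦(n : ℤ)⟧)
  | 0, _, _, g => ShiftedHom.mk₀ ((0 : ℕ) : ℤ) (by simp) g.down.hom
  | _ + 1, A, B, x => Quot.lift (fun E : NExt P A _ B => val E) (fun E E' h => by
      simpa using (val_natural (𝟙 A) (𝟙 B) E E' ((rel_iff_isOver E E').1 h)).symm) x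

/-! ### The Baer sum -/

/-- The direct sum of two objects of the subcategory. -/
noncomputable def dsum (A A' : P.FullSubcategory) : P.FullSubcategory :=
  ⟨A.obj ⊞ A'.obj, IsDyerSubcategory.ext_closed _
    (binaryBiproductTriangle_distinguished A.obj A'.obj) A.property A'.property⟩

/-- The direct sum of two morphisms of the subcategory. -/
noncomputable def dsumMap {A A' B B' : P.FullSubcategory} (f : A ⟶ B) (f' : A' ⟶ B') :
    dsum A A' ⟶ dsum B B' :=
  P.homMk (biprod.map f.hom f'.hom)

lemma dsumMap_comp {A A' B B' Z Z' : P.FullSubcategory} (f : A ⟶ B) (f' : A' ⟶ B')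
    (g : B ⟶ Z) (g' : B' ⟶ Z') :
    dsumMap f f' ≫ dsumMap g g' = dsumMap (f ≫ g) (f' ≫ g') := by
  ext
  change biprod.map _ _ ≫ biprod.map _ _ = biprod.map _ _
  ext <;> simp

lemma dsumMap_id (A A' : P.FullSubcategory) : dsumMap (𝟙 A) (𝟙 A') = 𝟙 (dsum A A') := by
  ext
  change biprod.map _ _ = 𝟙 (A.obj ⊞ A'.obj)
  ext <;> simp

/-- The diagonal `A ⟶ A ⊕ A`. -/
noncomputable def diagonal (A : P.FullSubcategory) : A ⟶ dsum A A :=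
  P.homMk (biprod.lift (𝟙 A.obj) (𝟙 A.obj))

/-- The codiagonal `B ⊕ B ⟶ B`. -/
noncomputable def codiagonal (B : P.FullSubcategory) : dsum B B ⟶ B :=
  P.homMk (biprod.desc (𝟙 B.obj) (𝟙 B.obj))

lemma dsum_conf {B X A B' X' A' : P.FullSubcategory} {i : B ⟶ X} {p : X ⟶ A} {i' : B' ⟶ X'}
    {p' : X' ⟶ A'} (h : triangleConflations P i p) (h' : triangleConflations P i' p') :
    triangleConflations P (dsumMap i i') (dsumMap p p') := by
  obtain ⟨γ, hγ⟩ := h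
  obtain ⟨γ', hγ'⟩ := h'
  exact biprod_distinguished hγ hγ'

/-- The direct sum of two extensions. -/
noncomputable def extSum {A A' : P.FullSubcategory} : ∀ {k : ℕ} {B B' : P.FullSubcategory},
    NExt P A k B → NExt P A' k B' → NExt P (dsum A A') k (dsum B B')
  | _, _, _, single i p h, single i' p' h' =>
      single (dsumMap i i') (dsumMap p p') (dsum_conf h h')
  | _, _, _, splice i p h E, splice i' p' h' E' =>
      splice (dsumMap i i') (dsumMap p p') (dsum_conf h h') (extSum E E')

lemma extSum_isOver {A₁ A₁' A₂ A₂' : P.FullSubcategory} {α : A₁ ⟶ A₂} {α' : A₁' ⟶ A₂'} {k : ℕ}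
    {B₁ B₁' B₂ B₂' : P.FullSubcategory} {β : B₁ ⟶ B₂} {β' : B₁' ⟶ B₂'}
    {E₁ : NExt P A₁ k B₁} {E₁' : NExt P A₁' k B₁'} {E₂ : NExt P A₂ k B₂} {E₂' : NExt P A₂' k B₂'}
    (h : IsOver α β E₁ E₂) (h' : IsOver α' β' E₁' E₂') :
    IsOver (dsumMap α α') (dsumMap β β') (extSum E₁ E₁') (extSum E₂ E₂') := by
  induction E₁ generalizing B₂ B₁' B₂' with
  | single i p hc =>
    cases E₁' with
    | single _ _ _ =>
    cases E₂ with
    | single _ _ _ =>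
    cases E₂' with
    | single _ _ _ =>
    obtain ⟨ψ, h₁, h₂⟩ := h
    obtain ⟨ψ', h₁', h₂'⟩ := h'
    exact ⟨dsumMap ψ ψ', by rw [dsumMap_comp, dsumMap_comp, h₁, h₁'],
      by rw [dsumMap_comp, dsumMap_comp, h₂, h₂']⟩
  | splice i p hc E ih =>
    cases E₁' with
    | splice _ _ _ _ =>
    cases E₂ with
    | splice _ _ _ _ =>
    cases E₂' with
    | splice _ _ _ _ =>
    obtain ⟨ψ, φ, h₁, h₂, h₃⟩ := h
    obtain ⟨ψ', φ', h₁', h₂', h₃'⟩ := h'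
    exact ⟨dsumMap ψ ψ', dsumMap φ φ', by rw [dsumMap_comp, dsumMap_comp, h₁, h₁'],
      by rw [dsumMap_comp, dsumMap_comp, h₂, h₂'], ih h₃ h₃'⟩

/-- The product `g · E` of an extension `E` of `A` by `B` with `g : B ⟶ B'`: the first conflation
`B ⟶ X₁ ⟶ C₁` is replaced by its pushout `B' ⟶ g · X₁ ⟶ C₁`. -/
noncomputable def push {A : P.FullSubcategory} : ∀ {k : ℕ} {B B' : P.FullSubcategory},
    (B ⟶ B') → NExt P A k B → NExt P A k B'
  | _, _, _, g, single _ _ h => single (pushData h g).j (pushData h g).q (pushData h g).conf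
  | _, _, _, g, splice _ _ h E => splice (pushData h g).j (pushData h g).q (pushData h g).conf E

/-- The product `E · a` of an extension `E` of `A` by `B` with `a : A' ⟶ A`: the last conflation
`C_k ⟶ X_{k+1} ⟶ A` is replaced by its pullback along `a`. -/
noncomputable def pull {A A' : P.FullSubcategory} (a : A' ⟶ A) :
    ∀ {k : ℕ} {B : P.FullSubcategory}, NExt P A k B → NExt P A' k B
  | _, _, single _ _ h => single (pullData h a).j (pullData h a).q (pullData h a).conf
  | _, _, splice i p h E => splice i p h (pull a E)

lemma isOver_push {A : P.FullSubcategory} {k : ℕ} {B B' : P.FullSubcategory} (g : B ⟶ B')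
    (E : NExt P A k B) : IsOver (𝟙 A) g E (push g E) := by
  cases E with
  | single i p h => exact ⟨_, (pushData h g).w₁, (pushData h g).w₂⟩
  | splice i p h E => exact ⟨_, 𝟙 _, (pushData h g).w₁, (pushData h g).w₂, .refl _⟩

lemma isOver_pull {A A' : P.FullSubcategory} (a : A' ⟶ A) {k : ℕ} {B : P.FullSubcategory}
    (E : NExt P A k B) : IsOver a (𝟙 B) (pull a E) E := by
  induction E with
  | single i p h => exact ⟨_, (pullData h a).w₁, (pullData h a).w₂⟩
  | splice i p h E ih => exact ⟨𝟙 _, 𝟙 _, by simp, by simp, ih⟩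

lemma push_isOver {A A' : P.FullSubcategory} {α : A ⟶ A'} {k : ℕ} {B B' : P.FullSubcategory}
    {g : B ⟶ B'} {E : NExt P A k B} {G : NExt P A' k B'} (h : IsOver α g E G) :
    IsOver α (𝟙 B') (push g E) G := by
  cases E with
  | single i p hc =>
    cases G with
    | single j q hd =>
    obtain ⟨ψ, h₁, h₂⟩ := h
    exact exists_middle (pushData hc g).conf hd _ _
      (by simpa [(pushData hc g).conn_eq] using conn_natural hc hd g ψ α h₁ h₂)
  | splice i p hc E =>
    cases G with
    | splice j q hd G =>
    obtain ⟨ψ, φ, h₁, h₂, h₃⟩ := h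
    obtain ⟨θ, h₄, h₅⟩ := exists_middle (pushData hc g).conf hd (𝟙 _) φ
      (by simpa [(pushData hc g).conn_eq] using conn_natural hc hd g ψ φ h₁ h₂)
    exact ⟨θ, φ, h₄, h₅, h₃⟩

lemma pull_isOver {A A' : P.FullSubcategory} {a : A' ⟶ A} {k : ℕ} {B B' : P.FullSubcategory}
    {β : B' ⟶ B} {E : NExt P A k B} {G : NExt P A' k B'} (h : IsOver a β G E) :
    IsOver (𝟙 A') β G (pull a E) := by
  induction G generalizing B with
  | single j q hd =>
    cases E with
    | single i p hc =>
    obtain ⟨ψ, h₁, h₂⟩ := h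
    exact exists_middle hd (pullData hc a).conf _ _
      (by simpa [(pullData hc a).conn_eq] using conn_natural hd hc β ψ a h₁ h₂)
  | splice j q hd G ih =>
    cases E with
    | splice i p hc E =>
    obtain ⟨ψ, φ, h₁, h₂, h₃⟩ := h
    exact ⟨ψ, φ, h₁, h₂, ih h₃⟩

/-- The Baer sum `∇ · ((E ⊕ E') · Δ)` of two extensions. -/
noncomputable def baerSum {A : P.FullSubcategory} {k : ℕ} {B : P.FullSubcategory}
    (E E' : NExt P A k B) : NExt P A k B :=
  push (codiagonal B) (pull (diagonal A) (extSum E E'))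

lemma baerSum_rel {A : P.FullSubcategory} {k : ℕ} {B : P.FullSubcategory}
    {E₁ E₁' E₂ E₂' : NExt P A k B} (h : IsOver (𝟙 A) (𝟙 B) E₁ E₂)
    (h' : IsOver (𝟙 A) (𝟙 B) E₁' E₂') : NExtension.Rel (baerSum E₁ E₁') (baerSum E₂ E₂') := by
  rw [rel_iff_isOver]
  have h₁ := extSum_isOver h h'
  rw [dsumMap_id, dsumMap_id] at h₁
  have h₂ := (isOver_pull (diagonal A) (extSum E₁ E₁')).comp h₁
  rw [comp_id, comp_id] at h₂
  have h₃ := (pull_isOver h₂).comp (isOver_push (codiagonal B) _)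
  rw [comp_id, id_comp] at h₃
  exact push_isOver h₃

/-- The addition on `Extⁿ(A, B)`: addition of morphisms for `n = 0`, the Baer sum for `n > 0`. -/
noncomputable def extAdd : ∀ (n : ℕ) (A B : P.FullSubcategory),
    YExt (triangleConflations P) n A B → YExt (triangleConflations P) n A B →
      YExt (triangleConflations P) n A B
  | 0, _, _, g, g' => ULift.up (g.down + g'.down)
  | _ + 1, _, _, x, y => Quot.map₂ baerSum
      (fun E _ _ h => baerSum_rel (.refl E) ((rel_iff_isOver _ _).1 h))
      (fun _ _ E h => baerSum_rel ((rel_iff_isOver _ _).1 h) (.refl E)) x y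

noncomputable instance (n : ℕ) (A B : P.FullSubcategory) :
    Add (YExt (triangleConflations P) n A B) := ⟨extAdd n A B⟩

variable (P) in
/-- The ambient triangulated category has all the Ext groups of `P`: the map
`f_{n,A,B} : Extⁿ(A, B) ⟶ Hom(A, B[n])` is an isomorphism of groups for all `n`, `A` and `B`. -/
def HasAllExtGroups : Prop :=
  ∀ (n : ℕ) (A B : P.FullSubcategory),
    ∃ e : YExt (triangleConflations P) n A B ≃+ (A.obj ⟶ B.obj⟦(n : ℤ)⟧),
      ∀ x, e x = extMap n A B x

end Dyer

/-- The heart of a t-structure satisfies the conditions of `IsDyerSubcategory`. -/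
instance (t : TStructure C) : IsDyerSubcategory t.heart where
  exists_zero := by
    have := t.isLE_of_isZero (isZero_zero C) 0
    have := t.isGE_of_isZero (isZero_zero C) 0
    exact ⟨_, isZero_zero C, (t.mem_heart_iff _).2 ⟨inferInstance, inferInstance⟩⟩
  ext_closed T hT h₁ h₃ := by
    obtain ⟨_, _⟩ := (t.mem_heart_iff _).1 h₁
    obtain ⟨_, _⟩ := (t.mem_heart_iff _).1 h₃
    exact (t.mem_heart_iff _).2 ⟨t.isLE₂ T hT 0 inferInstance inferInstance,
      t.isGE₂ T hT 0 inferInstance inferInstance⟩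
  hom_zero {A B} hA hB f := by
    obtain ⟨_, _⟩ := (t.mem_heart_iff _).1 hA
    obtain ⟨_, _⟩ := (t.mem_heart_iff _).1 hB
    have := t.isGE_shift B 0 (-1) 1
    exact t.zero f 0 1

end Triangulated

end ExtGroups

/-!
A connecting morphism of a conflation is an arbitrary morphism `A ⟶ B[1]`, so the morphisms in the
image of `f_{n,A,B}` are exactly those which factor through shifts of objects of the subcategory,
and the criterion says that surjectivity of all `f_{n,A,B}` implies injectivity. Let
`γ : K ⟶ B[1]` and `γ' : K' ⟶ B[1]` be the first connecting morphisms of two `(n + 1)`-extensions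
with the same image, and let `F` and `F'` be the remaining `n`-extensions, of `A` by `K` and `K'`.
The homotopy pullback `Z` of `γ` and `γ'` is an extension of `K ⊕ K'` by `B`, hence lies in the
subcategory, and the images of `F` and `F'` lift to a common morphism `A ⟶ Z[n]`. By surjectivity
it comes from an extension `G` of `A` by `Z`. By induction on `n`, the classes of `F` and `F'` are
the pushouts of `G` along `Z ⟶ K` and `Z ⟶ K'`; moving these morphisms across the splices, both
given extensions become the splice of `G` with the same conflation.

In the heart of a t-structure, the truncations of the cone of a morphism give its kernel and its
cokernel. Hence every epimorphism belongs to a conflation, and short exact sequences are the same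
as conflations.
-/

namespace ExtGroups

open NExtension

lemma exists_shiftedHom_comp_eq {C : Type u} [Category.{v} C] {M : Type*} [AddGroup M]
    [HasShift C M] {a b c : M} (hc : a + b = c) {K B : C} (h : K⟦b⟧ ⟶ B⟦c⟧) :
    ∃ γ : ShiftedHom K B a, ∀ {A : C} (g : ShiftedHom A K b), g.comp γ hc = g ≫ h := by
  let e := shiftFunctorAdd' C a b c hc
  refine ⟨(shiftFunctor C b).preimage (h ≫ e.hom.app B), fun g => ?_⟩
  rw [ShiftedHom.comp, Functor.map_preimage, assoc, Iso.hom_inv_id_app, comp_id]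

section Dimension

variable {C : Type u} [Category.{v} C] [Preadditive C] [HasShift C ℤ] {P : ObjectProperty C}

lemma FactorsThrough.zero {A B : C} (hB : P B) (n : ℕ) : FactorsThrough P A (n + 1) B 0 := by
  induction n with
  | zero => exact .one _
  | succ n ih => simpa using FactorsThrough.step hB 0 ih (0 : _ ⟶ B⟦((n + 1 + 1 : ℕ) : ℤ)⟧)

lemma eq_zero_of_dimIn_lt {n : ℤ} (h : dimIn P < ((n : WithTop ℤ) : WithBot (WithTop ℤ)))
    {A B : C} (hA : P A) (hB : P B) (f : A ⟶ B⟦n⟧) : f = 0 := by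
  by_contra hf
  exact h.not_ge (le_iSup₂_of_le n ⟨A, B, hA, hB, f, hf⟩ le_rfl)

lemma factorsThrough_of_dimIn_le_one (h : dimIn P ≤ 1) {n : ℕ} (hn : 1 ≤ n) {A B : C}
    (hA : P A) (hB : P B) (g : A ⟶ B⟦(n : ℤ)⟧) : FactorsThrough P A n B g := by
  obtain rfl | hn := hn.eq_or_lt
  · exact .one g
  · obtain ⟨k, rfl⟩ := Nat.exists_eq_add_of_le' hn.le
    rw [eq_zero_of_dimIn_lt (h.trans_lt (by norm_cast)) hA hB g]
    exact .zero hB k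

end Dimension

section ShortExact

variable {D : Type u} [Category.{v} D] [HasZeroMorphisms D] [HasZeroObject D]
  {S : ShortComplex D}

open ZeroObject in
lemma shortExact_of_isLimit_of_isColimit (hi : IsLimit (KernelFork.ofι S.f S.zero))
    (hp : IsColimit (CokernelCofork.ofπ S.g S.zero)) : S.ShortExact := by
  have : Mono S.f := mono_of_isLimit_fork hi
  have : Epi S.g := epi_of_isColimit_cofork hp
  let H : S.HomologyData :=
    { left :=
        { K := S.X₁, H := 0, i := S.f, π := 0, wi := S.zero, hi := hi, wπ := comp_zero
          hπ := CokernelCofork.IsColimit.ofEpiOfIsZero _ (by rw [hi.lift_self]; infer_instance)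
            (isZero_zero D) }
      right :=
        { Q := S.X₃, H := 0, p := S.g, ι := 0, wp := S.zero, hp := hp, wι := zero_comp
          hι := KernelFork.IsLimit.ofMonoOfIsZero _ (by
            rw [hp.desc_self]; exact inferInstanceAs (Mono (𝟙 S.X₃)))
            (isZero_zero D) }
      iso := Iso.refl 0
      comm := by simp }
  exact { exact := ⟨H, isZero_zero D⟩, mono_f := ‹_›, epi_g := ‹_› }

end ShortExact

section Triangulated

variable {C : Type u} [Category.{v} C] [Preadditive C] [HasZeroObject C] [HasShift C ℤ]
  [∀ n : ℤ, (shiftFunctor C n).Additive] [Pretriangulated C]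

section HomotopyPullback

lemma coyoneda_exact₂_shift {T : Triangle C} (hT : T ∈ distTriang C) {n : ℤ} {A : C}
    (f : A ⟶ T.obj₂⟦n⟧) (hf : f ≫ T.mor₂⟦n⟧' = 0) : ∃ w : A ⟶ T.obj₁⟦n⟧, w ≫ T.mor₁⟦n⟧' = f :=
  (ShortComplex.ab_exact_iff _).1
    ((preadditiveCoyoneda.obj (.op A)).homologySequence_exact₂ T hT n) f hf

variable {K K' W Z : C} {q : Z ⟶ K ⊞ K'} {γ : K ⟶ W} {γ' : K' ⟶ W} {δ : W ⟶ Z⟦(1 : ℤ)⟧}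

lemma homotopyPullback_condition (hT : Triangle.mk q (biprod.desc γ (-γ')) δ ∈ distTriang C) :
    (q ≫ biprod.fst) ≫ γ = (q ≫ biprod.snd) ≫ γ' := by
  have hq : q ≫ biprod.desc γ (-γ') = 0 := comp_distTriang_mor_zero₁₂ _ hT
  simpa [biprod.desc_eq, ← sub_eq_add_neg, sub_eq_zero] using hq

lemma homotopyPullback_exists_lift
    (hT : Triangle.mk q (biprod.desc γ (-γ')) δ ∈ distTriang C) {A : C} {n : ℤ}
    (f : A ⟶ K⟦n⟧) (f' : A ⟶ K'⟦n⟧) (hff' : f ≫ γ⟦n⟧' = f' ≫ γ'⟦n⟧') :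
    ∃ w : A ⟶ Z⟦n⟧, w ≫ (q ≫ biprod.fst)⟦n⟧' = f ∧ w ≫ (q ≫ biprod.snd)⟦n⟧' = f' := by
  let F : A ⟶ (K ⊞ K')⟦n⟧ := f ≫ biprod.inl⟦n⟧' + f' ≫ biprod.inr⟦n⟧'
  have hF : F ≫ (biprod.desc γ (-γ'))⟦n⟧' = 0 := by
    simp [F, ← Functor.map_comp, hff']
  obtain ⟨(w : A ⟶ Z⟦n⟧), (hw : w ≫ q⟦n⟧' = F)⟩ := coyoneda_exact₂_shift hT F hF
  refine ⟨w, ?_, ?_⟩ <;> (rw [Functor.map_comp, reassoc_of% hw]; simp [F, ← Functor.map_comp])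

end HomotopyPullback

variable {P : ObjectProperty C}

section Extensions

lemma val_single {A B X : P.FullSubcategory} {i : B ⟶ X} {p : X ⟶ A}
    (h : triangleConflations P i p) :
    val (single i p h) = (conn h : A.obj ⟶ B.obj⟦(1 : ℤ)⟧) :=
  ShiftedHom.mk₀_id_comp (0 : ℤ) rfl (conn h)

lemma factorsThrough_val {A B : P.FullSubcategory} {k : ℕ} (E : NExt P A k B) :
    FactorsThrough P A.obj (k + 1) B.obj (val E) := by
  induction E with
  | single i p h => exact .one _
  | @splice k B X K i p h E ih => exact .step K.property _ ih _

variable [IsDyerSubcategory P]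

lemma val_push {A B B' : P.FullSubcategory} {k : ℕ} (g : B ⟶ B') (E : NExt P A k B) :
    val (push g E) = val E ≫ g.hom⟦((k + 1 : ℕ) : ℤ)⟧' := by
  simpa using val_natural (𝟙 A) g E _ (isOver_push g E)

lemma val_pull {A A' B : P.FullSubcategory} {k : ℕ} (a : A' ⟶ A) (E : NExt P A k B) :
    val (pull a E) = a.hom ≫ val E := by
  simpa using (val_natural a (𝟙 B) _ E (isOver_pull a E)).symm

/-- The first inclusion `A ⟶ A ⊕ A'`, as a morphism of the full subcategory. -/
noncomputable def dsumInl (A A' : P.FullSubcategory) : A ⟶ dsum A A' := P.homMk biprod.inl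

/-- The second inclusion `A' ⟶ A ⊕ A'`, as a morphism of the full subcategory. -/
noncomputable def dsumInr (A A' : P.FullSubcategory) : A' ⟶ dsum A A' := P.homMk biprod.inr

lemma dsumInl_dsumMap {A A' B B' : P.FullSubcategory} (f : A ⟶ B) (f' : A' ⟶ B') :
    dsumInl A A' ≫ dsumMap f f' = f ≫ dsumInl B B' := by
  ext
  exact biprod.inl_map _ _

lemma dsumInr_dsumMap {A A' B B' : P.FullSubcategory} (f : A ⟶ B) (f' : A' ⟶ B') :
    dsumInr A A' ≫ dsumMap f f' = f' ≫ dsumInr B B' := by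
  ext
  exact biprod.inr_map _ _

lemma isOver_dsumInl {A A' B B' : P.FullSubcategory} {k : ℕ} (E : NExt P A k B)
    (E' : NExt P A' k B') : IsOver (dsumInl A A') (dsumInl B B') E (extSum E E') := by
  induction E generalizing B' with
  | single i p h =>
    cases E' with
    | single i' p' h' =>
    exact ⟨dsumInl _ _, (dsumInl_dsumMap _ _).symm, dsumInl_dsumMap _ _⟩
  | splice i p h E ih =>
    cases E' with
    | splice i' p' h' E' =>
    exact ⟨dsumInl _ _, dsumInl _ _, (dsumInl_dsumMap _ _).symm, dsumInl_dsumMap _ _, ih E'⟩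

lemma isOver_dsumInr {A A' B B' : P.FullSubcategory} {k : ℕ} (E : NExt P A k B)
    (E' : NExt P A' k B') : IsOver (dsumInr A A') (dsumInr B B') E' (extSum E E') := by
  induction E generalizing B' with
  | single i p h =>
    cases E' with
    | single i' p' h' =>
    exact ⟨dsumInr _ _, (dsumInr_dsumMap _ _).symm, dsumInr_dsumMap _ _⟩
  | splice i p h E ih =>
    cases E' with
    | splice i' p' h' E' =>
    exact ⟨dsumInr _ _, dsumInr _ _, (dsumInr_dsumMap _ _).symm, dsumInr_dsumMap _ _, ih E'⟩

lemma diagonal_hom_eq (A : P.FullSubcategory) :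
    (diagonal A).hom = (dsumInl A A).hom + (dsumInr A A).hom := by
  have h : biprod.lift (𝟙 A.obj) (𝟙 A.obj) = biprod.inl + biprod.inr := by
    apply biprod.hom_ext <;> simp
  exact h

lemma dsumInl_codiagonal (B : P.FullSubcategory) :
    (dsumInl B B).hom ≫ (codiagonal B).hom = 𝟙 B.obj :=
  biprod.inl_desc _ _

lemma dsumInr_codiagonal (B : P.FullSubcategory) :
    (dsumInr B B).hom ≫ (codiagonal B).hom = 𝟙 B.obj :=
  biprod.inr_desc _ _

lemma val_baerSum {A B : P.FullSubcategory} {k : ℕ} (E E' : NExt P A k B) :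
    val (baerSum E E') = val E + val E' := by
  have h₁ := val_natural _ _ _ _ (isOver_dsumInl E E')
  have h₂ := val_natural _ _ _ _ (isOver_dsumInr E E')
  rw [baerSum, val_push, val_pull, diagonal_hom_eq, Preadditive.add_comp, h₁, h₂,
    Preadditive.add_comp, assoc, assoc, ← Functor.map_comp, ← Functor.map_comp,
    dsumInl_codiagonal, dsumInr_codiagonal, CategoryTheory.Functor.map_id, comp_id, comp_id]

lemma extMap_add (n : ℕ) (A B : P.FullSubcategory) (x y : YExt (triangleConflations P) n A B) :
    extMap n A B (x + y) = extMap n A B x + extMap n A B y := by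
  cases n with
  | zero => exact ShiftedHom.mk₀_add _ _ _ _
  | succ k =>
    induction x using Quot.ind
    induction y using Quot.ind
    exact val_baerSum _ _

lemma exists_extMap_eq_of_factorsThrough {A : P.FullSubcategory} {n : ℕ} {B : C}
    {g : A.obj ⟶ B⟦(n : ℤ)⟧} (h : FactorsThrough P A.obj n B g) (hB : P B) :
    ∃ x : YExt (triangleConflations P) n A ⟨B, hB⟩, extMap n A ⟨B, hB⟩ x = g := by
  induction h with
  | one g =>
    obtain ⟨Y, j, q, hc, hγ⟩ := exists_conf (A := A) (B := ⟨_, hB⟩) g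
    exact ⟨Quot.mk _ (single j q hc), (val_single hc).trans hγ⟩
  | @step n K B hK g hg f ih =>
    cases n with
    | zero => cases hg
    | succ k =>
      obtain ⟨⟨E⟩, hE : val E = g⟩ := ih hK
      obtain ⟨γ, hγ⟩ := exists_shiftedHom_comp_eq (a := (1 : ℤ)) (by push_cast; ring) f
      obtain ⟨Y, j, q, hc, hc'⟩ := exists_conf (A := ⟨K, hK⟩) (B := ⟨B, hB⟩) γ
      refine ⟨Quot.mk _ (splice j q hc E), ?_⟩
      change ShiftedHom.comp (val E) (conn hc) _ = _
      rw [hE, hc', hγ]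

lemma extMap_surjective_iff_factorsThrough (n : ℕ) (A B : P.FullSubcategory) :
    Function.Surjective (extMap (n + 1) A B) ↔
      ∀ g, FactorsThrough P A.obj (n + 1) B.obj g := by
  refine ⟨fun h g => ?_, fun h g => exists_extMap_eq_of_factorsThrough (h g) B.property⟩
  obtain ⟨⟨E⟩, rfl⟩ := h g
  exact factorsThrough_val E

lemma exists_homotopyPullback {B K K' : P.FullSubcategory} (γ : K.obj ⟶ B.obj⟦(1 : ℤ)⟧)
    (γ' : K'.obj ⟶ B.obj⟦(1 : ℤ)⟧) :
    ∃ (Z : P.FullSubcategory) (a : Z ⟶ K) (a' : Z ⟶ K'), a.hom ≫ γ = a'.hom ≫ γ' ∧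
      ∀ {A : C} {n : ℤ} (f : A ⟶ K.obj⟦n⟧) (f' : A ⟶ K'.obj⟦n⟧), f ≫ γ⟦n⟧' = f' ≫ γ'⟦n⟧' →
        ∃ w : A ⟶ Z.obj⟦n⟧, w ≫ a.hom⟦n⟧' = f ∧ w ≫ a'.hom⟦n⟧' = f' := by
  obtain ⟨Z, j, q, hT⟩ := distinguished_cocone_triangle₂ (biprod.desc γ (-γ'))
  have hZ : P Z := IsDyerSubcategory.ext_closed _ hT B.property (dsum K K').property
  have hT' := rot_of_distTriang _ hT
  exact ⟨⟨Z, hZ⟩, P.homMk (q ≫ biprod.fst), P.homMk (q ≫ biprod.snd),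
    homotopyPullback_condition hT', homotopyPullback_exists_lift hT'⟩

lemma mk_splice_congr {A B X K : P.FullSubcategory} {i : B ⟶ X} {p : X ⟶ K}
    (h : triangleConflations P i p) {k : ℕ} {F F' : NExt P A k K}
    (hF : Quot.mk NExtension.Rel F = Quot.mk NExtension.Rel F') :
    Quot.mk NExtension.Rel (splice i p h F) = Quot.mk NExtension.Rel (splice i p h F') := by
  refine congrArg (Quot.map (splice i p h) fun E E' hE => ?_) hF
  exact (rel_iff_isOver _ _).2 ⟨𝟙 _, 𝟙 _, by simp, by simp, (rel_iff_isOver E E').1 hE⟩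

lemma mk_splice_eq_mk_splice_push {A B Y Z X K : P.FullSubcategory} {j : B ⟶ Y} {q : Y ⟶ Z}
    {i : B ⟶ X} {p : X ⟶ K} (hj : triangleConflations P j q) (hi : triangleConflations P i p)
    (a : Z ⟶ K) (hconn : conn hj = a.hom ≫ conn hi) {k : ℕ} (G : NExt P A k Z) :
    Quot.mk NExtension.Rel (splice j q hj G) =
      Quot.mk NExtension.Rel (splice i p hi (push a G)) := by
  obtain ⟨ψ, h₁, h₂⟩ := exists_middle hj hi (𝟙 B) a (by simpa using hconn.symm)
  exact Quot.sound ((rel_iff_isOver _ _).2 ⟨ψ, a, h₁, h₂, isOver_push a G⟩)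

lemma mk_eq_mk_of_val_eq {A : P.FullSubcategory}
    (hs : ∀ (k : ℕ) (B : P.FullSubcategory), Function.Surjective (extMap (k + 1) A B))
    {k : ℕ} {B : P.FullSubcategory} (E E' : NExt P A k B) (h : val E = val E') :
    Quot.mk NExtension.Rel E = Quot.mk NExtension.Rel E' := by
  induction k generalizing B with
  | zero =>
    cases E with | single i p hc =>
    cases E' with | single i' p' hc' =>
    rw [val_single, val_single] at h
    exact Quot.sound ((rel_iff_isOver _ _).2 (exists_middle hc hc' _ _ (by simpa using h.symm)))
  | succ k ih =>
    cases E with | splice i p hc F =>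
    cases E' with | splice i' p' hc' F' =>
    obtain ⟨Z, a, a', haa', hZ⟩ := exists_homotopyPullback (conn hc) (conn hc')
    obtain ⟨w, hw, hw'⟩ := hZ (val F) (val F') (by
      simpa only [val, ShiftedHom.comp, ← assoc, cancel_mono] using h)
    obtain ⟨⟨G⟩, hG : val G = w⟩ := hs k Z w
    have hF := ih (push a G) F (by rw [val_push, hG, hw])
    have hF' := ih (push a' G) F' (by rw [val_push, hG, hw'])
    obtain ⟨Y, j, q, hj, hγ⟩ := exists_conf (a.hom ≫ conn hc)
    rw [← mk_splice_congr hc hF, ← mk_splice_congr hc' hF',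
      ← mk_splice_eq_mk_splice_push hj hc a hγ G,
      ← mk_splice_eq_mk_splice_push hj hc' a' (hγ.trans haa') G]

lemma extMap_injective_of_surjective {A : P.FullSubcategory}
    (hs : ∀ (k : ℕ) (B : P.FullSubcategory), Function.Surjective (extMap (k + 1) A B))
    (k : ℕ) (B : P.FullSubcategory) : Function.Injective (extMap (k + 1) A B) := by
  rintro ⟨E⟩ ⟨E'⟩ h
  exact mk_eq_mk_of_val_eq hs E E' h

lemma extMap_zero_bijective (A B : P.FullSubcategory) : Function.Bijective (extMap 0 A B) := by
  let e : YExt (triangleConflations P) 0 A B ≃ (A.obj ⟶ B.obj⟦((0 : ℕ) : ℤ)⟧) :=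
    (Equiv.ulift.trans P.fullyFaithfulι.homEquiv).trans
      (ShiftedHom.homEquiv ((0 : ℕ) : ℤ) (by simp))
  exact e.bijective

lemma hasAllExtGroups_iff_bijective :
    HasAllExtGroups P ↔ ∀ n A B, Function.Bijective (extMap (P := P) n A B) := by
  refine ⟨fun h n A B => ?_, fun h n A B => ?_⟩
  · obtain ⟨e, he⟩ := h n A B
    rw [← funext he]
    exact e.bijective
  · exact ⟨AddEquiv.mk (Equiv.ofBijective _ (h n A B)) (extMap_add n A B), fun _ => rfl⟩

lemma hasAllExtGroups_iff_surjective :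
    HasAllExtGroups P ↔ ∀ n A B, Function.Surjective (extMap (P := P) (n + 1) A B) := by
  rw [hasAllExtGroups_iff_bijective]
  refine ⟨fun h n A B => (h _ A B).2, fun hs n A B => ?_⟩
  cases n with
  | zero => exact extMap_zero_bijective A B
  | succ n => exact ⟨extMap_injective_of_surjective (fun k => hs k A) n B, hs n A B⟩

theorem hasAllExtGroups_iff_factorsThrough :
    HasAllExtGroups P ↔ ∀ (n : ℕ), 1 ≤ n → ∀ (A B : C), P A → P B → ∀ g : A ⟶ B⟦(n : ℤ)⟧,
      FactorsThrough P A n B g := by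
  simp only [hasAllExtGroups_iff_surjective, extMap_surjective_iff_factorsThrough]
  refine ⟨fun h n hn A B hA hB => ?_, fun h n A B =>
    h _ (Nat.le_add_left 1 n) _ _ A.property B.property⟩
  obtain ⟨k, rfl⟩ := Nat.exists_eq_add_of_le' hn
  exact h k ⟨A, hA⟩ ⟨B, hB⟩

theorem hasAllExtGroups_of_dimIn_le_one (h : dimIn P ≤ 1) : HasAllExtGroups P :=
  hasAllExtGroups_iff_factorsThrough.2 fun _ hn _ _ hA hB =>
    factorsThrough_of_dimIn_le_one h hn hA hB

lemma extDim_eq_dimIn_of_hasAllExtGroups (h : HasAllExtGroups P)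
    (hneg : ∀ ⦃n : ℤ⦄, n < 0 → ∀ {A B : C}, P A → P B → ∀ f : A ⟶ B⟦n⟧, f = 0) :
    extDim (triangleConflations P) = dimIn P := by
  apply le_antisymm
  · refine iSup₂_le fun n ⟨A, B, _⟩ => ?_
    obtain ⟨e, -⟩ := h n A B
    have := e.symm.toEquiv.nontrivial
    obtain ⟨f, hf⟩ := exists_ne (0 : A.obj ⟶ B.obj⟦(n : ℤ)⟧)
    exact le_iSup₂_of_le (n : ℤ) ⟨_, _, A.property, B.property, f, hf⟩ le_rfl
  · refine iSup₂_le fun n ⟨A, B, hA, hB, f, hf⟩ => ?_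
    obtain hn | hn := lt_or_ge n 0
    · exact (hf (hneg hn hA hB f)).elim
    · lift n to ℕ using hn
      obtain ⟨e, -⟩ := h n ⟨A, hA⟩ ⟨B, hB⟩
      have : Nontrivial (A ⟶ B⟦(n : ℤ)⟧) := ⟨f, 0, hf⟩
      exact le_iSup₂_of_le n ⟨⟨A, hA⟩, ⟨B, hB⟩, e.toEquiv.nontrivial⟩ le_rfl

end Extensions

section Conflations

lemma distinguished_iso_comp {X Y Z X' : C} {f : X ⟶ Y} {g : Y ⟶ Z} {h : Z ⟶ X⟦(1 : ℤ)⟧}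
    (hT : Triangle.mk f g h ∈ distTriang C) (e : X' ≅ X) :
    Triangle.mk (e.hom ≫ f) g (h ≫ e.inv⟦(1 : ℤ)⟧') ∈ distTriang C := by
  have he : (h ≫ e.inv⟦(1 : ℤ)⟧') ≫ e.hom⟦(1 : ℤ)⟧' = h := by
    rw [assoc, ← Functor.map_comp, Iso.inv_hom_id, CategoryTheory.Functor.map_id, comp_id]
  exact isomorphic_distinguished _ hT _ <| Triangle.isoMk _ _ e (Iso.refl _) (Iso.refl _)
    (comp_id _) ((comp_id _).trans (id_comp _).symm) (he.trans (id_comp _).symm)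

variable {B X A : P.FullSubcategory} {i : B ⟶ X} {p : X ⟶ A}

lemma conf_lift (h : triangleConflations P i p) {Z : P.FullSubcategory} (f : Z ⟶ X)
    (hf : f ≫ p = 0) : ∃ g : Z ⟶ B, g ≫ i = f := by
  obtain ⟨γ, hγ⟩ := h
  obtain ⟨g, hg⟩ := Triangle.coyoneda_exact₂ _ hγ f.hom (congrArg (·.hom) hf)
  exact ⟨P.homMk g, by ext; exact hg.symm⟩

lemma triangleConflations_iso_comp {B' : P.FullSubcategory} (e : B' ≅ B)
    (h : triangleConflations P i p) : triangleConflations P (e.hom ≫ i) p := by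
  obtain ⟨γ, hγ⟩ := h
  exact ⟨_, distinguished_iso_comp hγ (P.ι.mapIso e)⟩

variable [IsDyerSubcategory P]

instance : P.ContainsZero := ⟨IsDyerSubcategory.exists_zero⟩

/-- The first morphism of a conflation is a kernel of the second one. -/
noncomputable def isLimitKernelForkOfConf (h : triangleConflations P i p) :
    IsLimit (KernelFork.ofι i (conf_zero h)) :=
  have : Mono i := ⟨fun _ _ => conf_mono h⟩
  KernelFork.IsLimit.ofι' _ _ fun f hf =>
    ⟨(conf_lift h f hf).choose, (conf_lift h f hf).choose_spec⟩

/-- The second morphism of a conflation is a cokernel of the first one. -/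
noncomputable def isColimitCokernelCoforkOfConf (h : triangleConflations P i p) :
    IsColimit (CokernelCofork.ofπ p (conf_zero h)) :=
  have : Epi p := ⟨fun _ _ => conf_epi h⟩
  CokernelCofork.IsColimit.ofπ' _ _ fun f hf =>
    ⟨(conf_desc h f hf).choose, (conf_desc h f hf).choose_spec.symm⟩

lemma shortExact_of_triangleConflation (h : triangleConflations P i p) :
    shortExactSequences P.FullSubcategory i p :=
  ⟨conf_zero h, shortExact_of_isLimit_of_isColimit (S := .mk i p (conf_zero h))
    (isLimitKernelForkOfConf h) (isColimitCokernelCoforkOfConf h)⟩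

end Conflations

section Heart

variable (t : TStructure C)

lemma heart_hom_shift_eq_zero ⦃n : ℤ⦄ (hn : n < 0) {A B : C} (hA : t.heart A) (hB : t.heart B)
    (f : A ⟶ B⟦n⟧) : f = 0 := by
  obtain ⟨_, _⟩ := (t.mem_heart_iff _).1 hA
  obtain ⟨_, _⟩ := (t.mem_heart_iff _).1 hB
  have := t.isGE_shift B 0 n (-n)
  exact t.zero f 0 (-n)

lemma exists_distTriang_heart_shift_heart (X : C) [t.IsLE X 0] [t.IsGE X (-1)] :
    ∃ (K Q : t.heart.FullSubcategory) (α : K.obj⟦(1 : ℤ)⟧ ⟶ X) (β : X ⟶ Q.obj)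
      (γ : Q.obj ⟶ K.obj⟦(1 : ℤ)⟧⟦(1 : ℤ)⟧), Triangle.mk α β γ ∈ distTriang C := by
  obtain ⟨W, Q, hW, hQ, α, β, γ, hT⟩ := t.exists_triangle X (-1) 0 (by simp)
  rw [t.le_iff_isLE] at hW
  rw [t.ge_iff_isGE] at hQ
  have hQW := rot_of_distTriang _ hT
  have := t.isLE_shift W (-1) 1 (-2)
  have : t.IsLE Q 0 := t.isLE₂ _ hQW 0 ‹_› (t.isLE_of_le (W⟦(1 : ℤ)⟧) (-2) 0)
  have := t.isGE_shift Q 0 (-1) 1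
  have : t.IsGE W (-1) := t.isGE₂ _ (inv_rot_of_distTriang _ hT) (-1)
    (t.isGE_of_ge (Q⟦(-1 : ℤ)⟧) (-1) 1) ‹_›
  let K : t.heart.FullSubcategory := ⟨W⟦(-1 : ℤ)⟧,
    (t.mem_heart_iff _).2 ⟨t.isLE_shift W (-1) (-1) 0, t.isGE_shift W (-1) (-1) 0⟩⟩
  exact ⟨K, ⟨Q, (t.mem_heart_iff _).2 ⟨‹_›, ‹_›⟩⟩, _, _, _,
    distinguished_iso_comp hT (shiftNegShift W 1)⟩

lemma admissibleMorphism_heart_ι : AbelianSubcategory.admissibleMorphism t.heart.ι = ⊤ := by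
  ext A B f
  simp only [MorphismProperty.top_apply, iff_true]
  intro X f₂ f₃ hT
  obtain ⟨_, _⟩ := (t.mem_heart_iff _).1 A.property
  obtain ⟨_, _⟩ := (t.mem_heart_iff _).1 B.property
  have hBX := rot_of_distTriang _ hT
  have := t.isLE_shift A.obj 0 1 (-1)
  have := t.isGE_shift A.obj 0 1 (-1)
  have : t.IsLE X 0 := t.isLE₂ _ hBX 0 ‹_› (t.isLE_of_le (A.obj⟦(1 : ℤ)⟧) (-1) 0)
  have : t.IsGE X (-1) := t.isGE₂ _ hBX (-1) (t.isGE_of_ge B.obj (-1) 0) ‹_›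
  exact exists_distTriang_heart_shift_heart t X

lemma exists_triangleConflation_of_epi {X A : t.heart.FullSubcategory} (p : X ⟶ A) [Epi p] :
    ∃ (B : t.heart.FullSubcategory) (i : B ⟶ X), triangleConflations t.heart i p := by
  obtain ⟨B, i, γ, hT⟩ := AbelianSubcategory.exists_distinguished_triangle_of_epi
    (fun A B n f hn => heart_hom_shift_eq_zero t hn A.property B.property f)
    (admissibleMorphism_heart_ι t) p
  exact ⟨B, i, γ, hT⟩

instance : Balanced t.heart.FullSubcategory where
  isIso_of_mono_of_epi {X A} p _ _ := by
    obtain ⟨B, i, h⟩ := exists_triangleConflation_of_epi t p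
    have hi : i = 0 := by rw [← cancel_mono p, conf_zero h, zero_comp]
    obtain ⟨s, hs⟩ := conf_desc h (𝟙 X) (by rw [hi, zero_comp])
    exact ⟨s, hs.symm, by rw [← cancel_epi p, ← assoc, ← hs, id_comp, comp_id]⟩

lemma triangleConflation_of_shortExact {B X A : t.heart.FullSubcategory} {i : B ⟶ X} {p : X ⟶ A}
    (h : shortExactSequences t.heart.FullSubcategory i p) : triangleConflations t.heart i p := by
  obtain ⟨w, hS⟩ := h
  have : Mono i := hS.mono_f
  have : Epi p := hS.epi_g
  obtain ⟨B', i', h'⟩ := exists_triangleConflation_of_epi t p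
  let e : B ≅ B' := hS.exact.fIsKernel.conePointUniqueUpToIso (isLimitKernelForkOfConf h')
  have he : e.hom ≫ i' = i := IsLimit.conePointUniqueUpToIso_hom_comp _ _ WalkingParallelPair.zero
  exact he ▸ triangleConflations_iso_comp e h'

lemma shortExactSequences_heart :
    shortExactSequences t.heart.FullSubcategory = triangleConflations t.heart := by
  funext B X A i p
  exact propext ⟨triangleConflation_of_shortExact t, shortExact_of_triangleConflation⟩

lemma absDim_heart_eq_dimIn (h : HasAllExtGroups t.heart) :
    absDim t.heart.FullSubcategory = dimIn t.heart := by
  rw [absDim, shortExactSequences_heart]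
  exact extDim_eq_dimIn_of_hasAllExtGroups h (heart_hom_shift_eq_zero t)

end Heart

end Triangulated

end ExtGroups

theorem mainTheorem6_general {C : Type u} [Category.{v} C] [Preadditive C] [HasZeroObject C]
    [HasShift C ℤ] [∀ n : ℤ, (shiftFunctor C n).Additive] [Pretriangulated C] :
    (∀ (P : ObjectProperty C) [ExtGroups.IsDyerSubcategory P],
      ExtGroups.HasAllExtGroups P ↔
        ∀ (n : ℕ), 1 ≤ n → ∀ (A B : C), P A → P B → ∀ g : A ⟶ B⟦(n : ℤ)⟧,
          ExtGroups.FactorsThrough P A n B g) ∧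
    (∀ (P : ObjectProperty C) [ExtGroups.IsDyerSubcategory P], ExtGroups.dimIn P ≤ 1 →
      ExtGroups.HasAllExtGroups P) ∧
    (∀ t : TStructure C, ExtGroups.HasAllExtGroups t.heart →
      ExtGroups.absDim t.heart.FullSubcategory = ExtGroups.dimIn t.heart) :=
  ⟨fun _ _ => ExtGroups.hasAllExtGroups_iff_factorsThrough,
    fun _ _ => ExtGroups.hasAllExtGroups_of_dimIn_le_one, ExtGroups.absDim_heart_eq_dimIn⟩

theorem mainTheorem6 {C : Type u} [Category.{v} C] [Preadditive C] [HasZeroObject C] [HasShift C ℤ]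
    [∀ n : ℤ, (shiftFunctor C n).Additive] [Pretriangulated C] [IsTriangulated C] :
    (∀ (P : ObjectProperty C) [ExtGroups.IsDyerSubcategory P],
      ExtGroups.HasAllExtGroups P ↔
        ∀ (n : ℕ), 1 ≤ n → ∀ (A B : C), P A → P B → ∀ g : A ⟶ B⟦(n : ℤ)⟧,
          ExtGroups.FactorsThrough P A n B g) ∧
    (∀ t : TStructure C, ExtGroups.dimIn t.heart ≤ 1 →
      ExtGroups.HasAllExtGroups t.heart ∧
        ExtGroups.absDim t.heart.FullSubcategory = ExtGroups.dimIn t.heart) := by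
  obtain ⟨h₁, h₂, h₃⟩ := mainTheorem6_general (C := C)
  exact ⟨h₁, fun t ht => ⟨h₂ _ ht, h₃ t (h₂ _ ht)⟩⟩
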